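/- Let $d\in\mathbb N$, $p\in[1,\infty)$, and write points of the phase space $T^*\mathbb R^d=\mathbb R^d\times\mathbb R^d$ as $(q,p)$. For a control value $u=(u_0,\dots,u_d)\in\mathbb R^{d+1}$ let $$H_u(q,p)=\frac{|p|^2}{2}+u_0\frac{|q|^2}{2}+\sum_{j=1}^d u_jq_j,\qquad \{f,g\}=\partial_pf\cdot\partial_qg-\partial_qf\cdot\partial_pg .$$ For $\rho_0\in L^p(T^*\mathbb R^d,\mathbb R)$, $\tau\ge 0$ and a piecewise constant control $u:[0,\tau]\to\mathbb R^{d+1}$, consider the Liouville equation $\partial_t\rho=\{H_{u(t)},\rho\}$, $\rho(0)=\rho_0$. Its (mild) solution is the function $\rho\in C([0,\tau],L^p(T^*\mathbb R^d,\mathbb R))$ with $\rho(0)=\rho_0$ and $$\int\rho(t)\varphi\,dq\,dp=\int\rho_0\varphi\,dq\,dp-\int_0^t\int\rho(x)\{H_{u(x)},\varphi\}\,dq\,dp\,dx\qquad\text{for all } t\in[0,\tau],\ \varphi\in C_c^\infty(T^*\mathbb R^d).$$ A state $\rho_1\in L^p(T^*\mathbb R^d,\mathbb R)$ is small-time approximately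 reachable from $\rho_0$ if for every $\varepsilon>0$ there exist $\tau\in[0,\varepsilon]$ and a piecewise constant control $u$ on $[0,\tau]$ such that the solution satisfies $\|\rho(\tau)-\rho_1\|_{L^p}<\varepsilon$. Then, for every $\rho_0\in L^p(T^*\mathbb R^d,\mathbb R)$: 1. for all $\alpha>0$, $s,w\in\mathbb R^d$ and $t,r\in\mathbb R$ with $tr=0$, the state $(q,p)\mapsto\rho_0\big(\alpha(q+tp+s),\alpha^{-1}(p+rq+w)\big)$ belongs to $L^p(T^*\mathbb R^d,\mathbb R)$ and is small-time approximately reachable from $\rho_0$; 2. more generally, for all $a,b,c,e\in\mathbb R$ with $ae-bc=1$ and all $s,w\in\mathbb R^d$, the state $(q,p)\mapsto\rho_0(aq+bp+s,\;cq+ep+w)$ belongs to $L^p(T^*\mathbb R^d,\mathbb R)$ and is small-time approximately reachable from $\rho_0$. In particular, for all $\alpha>0$, $t,r\in\mathbb R$, $s,w\in\mathbb R^d$ this holds for the state obtained by performing the substitutions successively, $(q,p)\mapsto\rho_0\big(\alpha(q+tp+s),\alpha^{-1}(p+r(q+tp+s)+w)\big)$. -/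

import Mathlib

open MeasureTheory Set
open scoped ENNReal ContDiff

/-- The phase space `T*ℝᵈ = ℝᵈ × ℝᵈ`; a point is `z = (q, p)`. It carries Lebesgue measure. -/
abbrev PhaseSpace (d : ℕ) : Type :=
  EuclideanSpace ℝ (Fin d) × EuclideanSpace ℝ (Fin d)

/-- The Poisson bracket `{f, g} = ∂_p f · ∂_q g - ∂_q f · ∂_p g` on `T*ℝᵈ`. -/
noncomputable def poissonBracket {d : ℕ} (f g : PhaseSpace d → ℝ) (z : PhaseSpace d) : ℝ :=
  ∑ i : Fin d,
    (fderiv ℝ f z (0, EuclideanSpace.single i 1) * fderiv ℝ g z (EuclideanSpace.single i 1, 0)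
      - fderiv ℝ f z (EuclideanSpace.single i 1, 0) * fderiv ℝ g z (0, EuclideanSpace.single i 1))

/-- The Hamiltonian `H_u(q, p) = |p|²/2 + u₀ |q|²/2 + ∑ⱼ uⱼ qⱼ`, with control value
`u = (u₀, u₁, …, u_d)` in `ℝ^(d+1)`. -/
noncomputable def oscillatorHamiltonian {d : ℕ} (u : Fin (d + 1) → ℝ) (z : PhaseSpace d) : ℝ :=
  ‖z.2‖ ^ 2 / 2 + u 0 * (‖z.1‖ ^ 2 / 2) + ∑ j : Fin d, u j.succ * z.1 j

/-- `u` is piecewise constant on `[0, τ]`: there is a finite subdivision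
`0 = t₀ ≤ t₁ ≤ … ≤ tₙ = τ` such that `u` is constant on each open subinterval. -/
def IsPiecewiseConstantOn {E : Type*} (τ : ℝ) (u : ℝ → E) : Prop :=
  ∃ (n : ℕ) (t : ℕ → ℝ), Monotone t ∧ t 0 = 0 ∧ t n = τ ∧
    ∀ i < n, ∃ c : E, ∀ x ∈ Ioo (t i) (t (i + 1)), u x = c

/-- `ρ` is the (mild) solution on `[0, τ]` of the Liouville equation
`∂ₜ ρ = {H_{u(t)}, ρ}`, `ρ(0) = ρ₀`: it is continuous with values in `Lᵖ`, and
`ρ(t) = ρ₀ + ∫₀ᵗ {H_{u(x)}, ρ(x)} dx` for all `t ∈ [0, τ]`, where the bracket with `ρ(x)` is taken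
in the sense of distributions (the Hamiltonian vector field is divergence free, so
it is formally skew-adjoint). -/
def IsLiouvilleSolution {d : ℕ} {p : ℝ≥0∞} [Fact (1 ≤ p)] (τ : ℝ) (u : ℝ → Fin (d + 1) → ℝ)
    (ρ₀ : Lp ℝ p (volume : Measure (PhaseSpace d)))
    (ρ : ℝ → Lp ℝ p (volume : Measure (PhaseSpace d))) : Prop :=
  ContinuousOn ρ (Icc 0 τ) ∧ ρ 0 = ρ₀ ∧
    ∀ φ : PhaseSpace d → ℝ, ContDiff ℝ ∞ φ → HasCompactSupport φ → ∀ t ∈ Icc 0 τ,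
      ∫ z, ρ t z * φ z =
        (∫ z, ρ₀ z * φ z) -
          ∫ x in (0 : ℝ)..t, ∫ z, ρ x z * poissonBracket (oscillatorHamiltonian (u x)) φ z

/-- `ρ₁` is small-time approximately reachable from `ρ₀` for the controlled Liouville equation:
for every `ε > 0` there are a time `τ ∈ [0, ε]` and a piecewise constant control on `[0, τ]`
whose solution started at `ρ₀` is at time `τ` at `Lᵖ`-distance less than `ε` from `ρ₁`. -/
def IsSmallTimeApproxReachable {d : ℕ} {p : ℝ≥0∞} [Fact (1 ≤ p)]
    (ρ₀ ρ₁ : Lp ℝ p (volume : Measure (PhaseSpace d))) : Prop :=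
  ∀ ε : ℝ, 0 < ε → ∃ τ ∈ Icc 0 ε, ∃ u : ℝ → Fin (d + 1) → ℝ,
    IsPiecewiseConstantOn τ u ∧
      ∃ ρ : ℝ → Lp ℝ p (volume : Measure (PhaseSpace d)),
        IsLiouvilleSolution τ u ρ₀ ρ ∧ ‖ρ τ - ρ₁‖ < ε

/-! Under a constant control the mild solution is `ρ₀ ∘ Φ_t`, where `Φ_t` is the explicit affine
flow of `q' = p`, `p' = -(u₀ q + v)` (`IsOscillatorPair.weak_equation`). Switching controls composes
such flows, so the question is which maps are limits of compositions of total time at most `ε`. For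
a finite exponent, `g ↦ ρ₀ ∘ g` is continuous from the compact-open topology to `Lᵖ`, so limits can
be taken among maps, independently of `ρ₀`.

Two shears generate everything. Free transport `q ↦ q + δ p` costs time `δ`. A kick `p ↦ p + r q +
w` is almost free: controls of size `θ⁻²` acting for time `θ²` approach it as `θ → 0`
(`shear_fst_mem_approxRealized`). Two short transports separated by a large kick produce any
prescribed upper right entry `b`. If `b ≠ 0`, two outer kicks adjust the diagonal, and the unit
determinant forces the remaining entry (`sympAffine_mem_approxRealized_of_ne_zero`). A matrix with
`b = 0` is a product of two with `b ≠ 0`. -/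

/-! ### Volume preserving maps and their pullbacks on `Lᵖ` -/

/-- Continuous volume preserving self-maps of the phase space, with the compact-open topology. -/
abbrev VolumePreservingMap (d : ℕ) : Type :=
  {f : C(PhaseSpace d, PhaseSpace d) // MeasurePreserving f volume volume}

namespace VolumePreservingMap

variable {d : ℕ}

/-- Composition `g ∘ h`. -/
def comp (g h : VolumePreservingMap d) : VolumePreservingMap d :=
  ⟨g.1.comp h.1, g.2.comp h.2⟩

theorem continuous_uncurry_comp :
    Continuous (Function.uncurry (comp : VolumePreservingMap d → _ → _)) := by
  refine Continuous.subtype_mk ?_ _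
  exact ContinuousMap.continuous_comp'.comp
    ((continuous_subtype_val.comp continuous_snd).prodMk (continuous_subtype_val.comp continuous_fst))

/-- The pullback `ρ ↦ ρ ∘ g` on `Lᵖ`. -/
noncomputable def pullback {p : ℝ≥0∞} (g : VolumePreservingMap d)
    (ρ : Lp ℝ p (volume : Measure (PhaseSpace d))) : Lp ℝ p (volume : Measure (PhaseSpace d)) :=
  Lp.compMeasurePreserving g.1 g.2 ρ

theorem coeFn_pullback {p : ℝ≥0∞} (g : VolumePreservingMap d)
    (ρ : Lp ℝ p (volume : Measure (PhaseSpace d))) :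
    g.pullback ρ =ᵐ[volume] fun z ↦ ρ (g.1 z) :=
  Lp.coeFn_compMeasurePreserving ρ g.2

theorem pullback_comp {p : ℝ≥0∞} (g h : VolumePreservingMap d)
    (ρ : Lp ℝ p (volume : Measure (PhaseSpace d))) :
    (g.comp h).pullback ρ = h.pullback (g.pullback ρ) :=
  Lp.compMeasurePreserving_comp_apply ρ g.2 h.2

theorem continuous_pullback {p : ℝ≥0∞} [Fact (1 ≤ p)] (hp : p ≠ ⊤)
    (ρ : Lp ℝ p (volume : Measure (PhaseSpace d))) :
    Continuous fun g : VolumePreservingMap d ↦ g.pullback ρ :=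
  continuous_const.compMeasurePreservingLp continuous_subtype_val (fun g ↦ g.2) hp

end VolumePreservingMap

/-! ### Affine maps of unit determinant -/

section Affine

variable {d : ℕ}

/-- The affine map `(q, p) ↦ (a q + b p + s, c q + e p + w)` of the phase space. -/
def phaseAffine (a b c e : ℝ) (s w : EuclideanSpace ℝ (Fin d)) (z : PhaseSpace d) :
    PhaseSpace d :=
  (a • z.1 + b • z.2 + s, c • z.1 + e • z.2 + w)

theorem continuous_phaseAffine {T : Type*} [TopologicalSpace T] {a b c e : T → ℝ}
    {s w : T → EuclideanSpace ℝ (Fin d)} {z : T → PhaseSpace d} (ha : Continuous a)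
    (hb : Continuous b) (hc : Continuous c) (he : Continuous e) (hs : Continuous s)
    (hw : Continuous w) (hz : Continuous z) :
    Continuous fun x ↦ phaseAffine (a x) (b x) (c x) (e x) (s x) (w x) (z x) := by
  unfold phaseAffine
  fun_prop

theorem phaseAffine_comp (a b c e a' b' c' e' : ℝ) (s w s' w' : EuclideanSpace ℝ (Fin d)) :
    phaseAffine a b c e s w ∘ phaseAffine a' b' c' e' s' w' =
      phaseAffine (a * a' + b * c') (a * b' + b * e') (c * a' + e * c') (c * b' + e * e')
        (a • s' + b • w' + s) (c • s' + e • w' + w) := by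
  funext z
  simp only [phaseAffine, Function.comp_apply, Prod.mk.injEq]
  constructor <;> module

theorem measurePreserving_shear_fst (c : ℝ) (w : EuclideanSpace ℝ (Fin d)) :
    MeasurePreserving (phaseAffine 1 0 c 1 0 w) volume volume := by
  have h := (MeasurePreserving.id (volume : Measure (EuclideanSpace ℝ (Fin d)))).skew_product
    (μc := (volume : Measure (EuclideanSpace ℝ (Fin d))))
    (μd := (volume : Measure (EuclideanSpace ℝ (Fin d))))
    (g := fun q p ↦ p + (c • q + w)) (by fun_prop)
    (ae_of_all _ fun q ↦ (measurePreserving_add_right volume (c • q + w)).map_eq)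
  have e : phaseAffine 1 0 c 1 0 w = fun z : PhaseSpace d ↦ (id z.1, z.2 + (c • z.1 + w)) := by
    funext z
    simp only [phaseAffine, id, Prod.mk.injEq]
    constructor <;> module
  rw [e]
  exact h

theorem measurePreserving_shear_snd (b : ℝ) (s : EuclideanSpace ℝ (Fin d)) :
    MeasurePreserving (phaseAffine 1 b 0 1 s 0) volume volume := by
  have h := (Measure.measurePreserving_swap.comp (measurePreserving_shear_fst b s)).comp
    (Measure.measurePreserving_swap (μ := (volume : Measure (EuclideanSpace ℝ (Fin d))))
      (ν := (volume : Measure (EuclideanSpace ℝ (Fin d)))))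
  have e : phaseAffine 1 b 0 1 s 0 =
      (Prod.swap ∘ phaseAffine 1 0 b 1 0 s) ∘ (Prod.swap : PhaseSpace d → PhaseSpace d) := by
    funext z
    simp only [phaseAffine, Function.comp_apply, Prod.swap, Prod.mk.injEq]
    constructor <;> module
  rw [e]
  exact h

/-- A unit determinant matrix with `c ≠ 0` factors as upper shear, lower shear, upper shear, and
shears preserve volume by Fubini. -/
theorem measurePreserving_phaseAffine_of_ne_zero {a b c e : ℝ}
    (s w : EuclideanSpace ℝ (Fin d)) (h : a * e - b * c = 1) (hc : c ≠ 0) :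
    MeasurePreserving (phaseAffine a b c e s w) volume volume := by
  have key := (measurePreserving_shear_snd ((a - 1) / c) (s - ((a - 1) / c) • w)).comp
    ((measurePreserving_shear_fst c w).comp (measurePreserving_shear_snd ((e - 1) / c) 0))
  rw [phaseAffine_comp, phaseAffine_comp] at key
  convert key using 2
  · field_simp; ring
  · field_simp; linarith
  · ring
  · field_simp; ring
  · module
  · module

theorem measurePreserving_phaseAffine {a b c e : ℝ} (s w : EuclideanSpace ℝ (Fin d))
    (h : a * e - b * c = 1) : MeasurePreserving (phaseAffine a b c e s w) volume volume := by
  by_cases hc : c = 0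
  · subst hc
    have he : e ≠ 0 := by rintro rfl; simp at h
    -- Splitting off a lower shear on the right turns the lower left entry into `e`, which is
    -- nonzero because `a * e = 1`.
    have key := (measurePreserving_phaseAffine_of_ne_zero (a := a + b) (b := b) (c := e) (e := e)
      s w (by linarith) he).comp (measurePreserving_shear_fst (-1) 0)
    rw [phaseAffine_comp] at key
    convert key using 2
    · ring
    · ring
    · ring
    · ring
    · module
    · module
  · exact measurePreserving_phaseAffine_of_ne_zero s w h hc

/-- `phaseAffine` with unit determinant, as a volume preserving map. -/
def sympAffine (a b c e : ℝ) (s w : EuclideanSpace ℝ (Fin d)) (h : a * e - b * c = 1) :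
    VolumePreservingMap d :=
  ⟨⟨phaseAffine a b c e s w, continuous_phaseAffine continuous_const continuous_const
    continuous_const continuous_const continuous_const continuous_const continuous_id⟩,
    measurePreserving_phaseAffine s w h⟩

theorem continuous_sympAffine {T : Type*} [TopologicalSpace T] {a b c e : T → ℝ}
    {s w : T → EuclideanSpace ℝ (Fin d)} (h : ∀ x, a x * e x - b x * c x = 1) (ha : Continuous a)
    (hb : Continuous b) (hc : Continuous c) (he : Continuous e) (hs : Continuous s)
    (hw : Continuous w) :
    Continuous fun x ↦ sympAffine (a x) (b x) (c x) (e x) (s x) (w x) (h x) := by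
  refine Continuous.subtype_mk (ContinuousMap.continuous_of_continuous_uncurry _ ?_) _
  exact continuous_phaseAffine (ha.comp continuous_fst) (hb.comp continuous_fst)
    (hc.comp continuous_fst) (he.comp continuous_fst) (hs.comp continuous_fst)
    (hw.comp continuous_fst) continuous_snd

theorem sympAffine_eq {a b c e : ℝ} {s w : EuclideanSpace ℝ (Fin d)} {h : a * e - b * c = 1}
    {g : VolumePreservingMap d} (hg : phaseAffine a b c e s w = g.1) :
    sympAffine a b c e s w h = g :=
  Subtype.ext (ContinuousMap.ext fun z ↦ congrFun hg z)

end Affine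

/-! ### Explicit flow of the forced oscillator -/

section Oscillator

/-- `f'' = 1 - κ f` with `f 0 = f' 0 = 0`, written as a first order system with its first
integral. -/
structure IsOscillatorPair (κ : ℝ) (f s : ℝ → ℝ) : Prop where
  hasDerivAt_fst : ∀ t, HasDerivAt f (s t) t
  hasDerivAt_snd : ∀ t, HasDerivAt s (1 - κ * f t) t
  fst_zero : f 0 = 0
  snd_zero : s 0 = 0
  sq_snd : ∀ t, s t ^ 2 = f t * (2 - κ * f t)
  fst_neg : ∀ t, f (-t) = f t
  snd_neg : ∀ t, s (-t) = -s t

/-- Time scaling serves twice: it reduces existence to `κ ∈ {-1, 0, 1}`, and it supplies the strong,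
brief controls behind the kicks. -/
theorem IsOscillatorPair.rescale {κ : ℝ} {f s : ℝ → ℝ} (h : IsOscillatorPair κ f s) {l : ℝ}
    (hl : l ≠ 0) :
    IsOscillatorPair (κ / l ^ 2) (fun t ↦ l ^ 2 * f (t / l)) (fun t ↦ l * s (t / l)) where
  hasDerivAt_fst t := by
    have := ((h.hasDerivAt_fst (t / l)).comp t ((hasDerivAt_id t).div_const l)).const_mul (l ^ 2)
    refine this.congr_deriv ?_
    field_simp
  hasDerivAt_snd t := by
    have := ((h.hasDerivAt_snd (t / l)).comp t ((hasDerivAt_id t).div_const l)).const_mul l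
    refine this.congr_deriv ?_
    field_simp
  fst_zero := by simp [h.fst_zero]
  snd_zero := by simp [h.snd_zero]
  sq_snd t := by
    have := h.sq_snd (t / l)
    rw [mul_pow, this]
    field_simp
  fst_neg t := by rw [neg_div, h.fst_neg]
  snd_neg t := by rw [neg_div, h.snd_neg, mul_neg]

theorem isOscillatorPair_zero : IsOscillatorPair 0 (fun t ↦ t ^ 2 / 2) id where
  hasDerivAt_fst t := ((hasDerivAt_pow 2 t).div_const 2).congr_deriv (by simp)
  hasDerivAt_snd t := (hasDerivAt_id t).congr_deriv (by simp)
  fst_zero := by simp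
  snd_zero := rfl
  sq_snd t := by simp
  fst_neg t := by simp
  snd_neg t := rfl

theorem isOscillatorPair_one : IsOscillatorPair 1 (fun t ↦ 1 - Real.cos t) Real.sin where
  hasDerivAt_fst t := ((Real.hasDerivAt_cos t).const_sub 1).congr_deriv (by simp)
  hasDerivAt_snd t := (Real.hasDerivAt_sin t).congr_deriv (by ring)
  fst_zero := by simp
  snd_zero := by simp
  sq_snd t := by nlinarith [Real.sin_sq_add_cos_sq t]
  fst_neg t := by simp
  snd_neg t := by simp

theorem isOscillatorPair_neg_one :
    IsOscillatorPair (-1) (fun t ↦ Real.cosh t - 1) Real.sinh where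
  hasDerivAt_fst t := (Real.hasDerivAt_cosh t).sub_const 1
  hasDerivAt_snd t := (Real.hasDerivAt_sinh t).congr_deriv (by ring)
  fst_zero := by simp
  snd_zero := by simp
  sq_snd t := by nlinarith [Real.cosh_sq t]
  fst_neg t := by simp
  snd_neg t := by simp

theorem exists_isOscillatorPair (κ : ℝ) : ∃ f s : ℝ → ℝ, IsOscillatorPair κ f s := by
  rcases lt_trichotomy κ 0 with h | rfl | h
  · have := isOscillatorPair_neg_one.rescale
      (inv_ne_zero (Real.sqrt_pos.2 (neg_pos.2 h)).ne')
    rw [inv_pow, Real.sq_sqrt (neg_pos.2 h).le, div_inv_eq_mul, neg_one_mul, neg_neg] at this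
    exact ⟨_, _, this⟩
  · exact ⟨_, _, isOscillatorPair_zero⟩
  · have := isOscillatorPair_one.rescale (inv_ne_zero (Real.sqrt_pos.2 h).ne')
    rw [inv_pow, Real.sq_sqrt h.le, div_inv_eq_mul, one_mul] at this
    exact ⟨_, _, this⟩

namespace IsOscillatorPair

variable {d : ℕ} {κ : ℝ} {f s : ℝ → ℝ}

theorem continuous_fst (h : IsOscillatorPair κ f s) : Continuous f :=
  continuous_iff_continuousAt.2 fun t ↦ (h.hasDerivAt_fst t).continuousAt

theorem continuous_snd (h : IsOscillatorPair κ f s) : Continuous s :=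
  continuous_iff_continuousAt.2 fun t ↦ (h.hasDerivAt_snd t).continuousAt

/-- This is the first integral `sq_snd` multiplied by `κ`. -/
theorem det_eq_one (h : IsOscillatorPair κ f s) (t : ℝ) :
    (1 - κ * f t) * (1 - κ * f t) - s t * (-(κ * s t)) = 1 := by
  linear_combination κ * h.sq_snd t

/-- The flow at time `t` of `q' = p`, `p' = -(κ q + v)`. -/
def flow (h : IsOscillatorPair κ f s) (v : EuclideanSpace ℝ (Fin d)) (t : ℝ) :
    VolumePreservingMap d :=
  sympAffine (1 - κ * f t) (s t) (-(κ * s t)) (1 - κ * f t) (-f t • v) (-s t • v)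
    (h.det_eq_one t)

theorem continuous_flow (h : IsOscillatorPair κ f s) (v : EuclideanSpace ℝ (Fin d)) :
    Continuous (h.flow v) := by
  have := h.continuous_fst
  have := h.continuous_snd
  exact continuous_sympAffine _ (by fun_prop) (by fun_prop) (by fun_prop) (by fun_prop)
    (by fun_prop) (by fun_prop)

theorem continuous_flow_apply (h : IsOscillatorPair κ f s) (v : EuclideanSpace ℝ (Fin d)) :
    Continuous fun x : ℝ × PhaseSpace d ↦ (h.flow v x.1).1 x.2 := by
  have h1 := h.continuous_fst
  have h2 := h.continuous_snd
  exact continuous_phaseAffine (by fun_prop) (by fun_prop) (by fun_prop) (by fun_prop)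
    (by fun_prop) (by fun_prop) _root_.continuous_snd

theorem flow_zero (h : IsOscillatorPair κ f s) (v : EuclideanSpace ℝ (Fin d)) (z : PhaseSpace d) :
    (h.flow v 0).1 z = z := by
  simp [flow, sympAffine, phaseAffine, h.fst_zero, h.snd_zero]

theorem flow_flow_neg (h : IsOscillatorPair κ f s) (v : EuclideanSpace ℝ (Fin d)) (t : ℝ)
    (z : PhaseSpace d) : (h.flow v t).1 ((h.flow v (-t)).1 z) = z := by
  have e1 := h.sq_snd t
  change (phaseAffine _ _ _ _ _ _ ∘ phaseAffine _ _ _ _ _ _) z = z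
  rw [phaseAffine_comp, h.fst_neg, h.snd_neg]
  simp only [phaseAffine]
  ext i
  · simp only [PiLp.add_apply, PiLp.smul_apply, smul_eq_mul, smul_smul]
    linear_combination (κ * z.1 i + v i) * e1
  · simp only [PiLp.add_apply, PiLp.smul_apply, smul_eq_mul, smul_smul]
    linear_combination (κ * z.2 i) * e1

theorem flow_neg_flow (h : IsOscillatorPair κ f s) (v : EuclideanSpace ℝ (Fin d)) (t : ℝ)
    (z : PhaseSpace d) : (h.flow v (-t)).1 ((h.flow v t).1 z) = z := by
  simpa using h.flow_flow_neg v (-t) z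

theorem hasDerivAt_flow_neg (h : IsOscillatorPair κ f s) (v : EuclideanSpace ℝ (Fin d)) (t : ℝ)
    (z : PhaseSpace d) :
    HasDerivAt (fun x ↦ (h.flow v (-x)).1 z)
      (-(((h.flow v (-t)).1 z).2, -(κ • ((h.flow v (-t)).1 z).1 + v))) t := by
  have e : (fun x ↦ (h.flow v (-x)).1 z) = fun x ↦
      ((1 - κ * f x) • z.1 + (-s x) • z.2 + -f x • v,
        (κ * s x) • z.1 + (1 - κ * f x) • z.2 + s x • v) := by
    funext x
    simp [flow, sympAffine, phaseAffine, h.fst_neg, h.snd_neg]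
  have e' : (h.flow v (-t)).1 z = ((1 - κ * f t) • z.1 + (-s t) • z.2 + -f t • v,
        (κ * s t) • z.1 + (1 - κ * f t) • z.2 + s t • v) := congrFun e t
  rw [e, e']
  have hf := h.hasDerivAt_fst t
  have hs := h.hasDerivAt_snd t
  have hc := (hf.const_mul κ).const_sub 1
  have h1 := ((hc.smul_const z.1).add (hs.neg.smul_const z.2)).add (hf.neg.smul_const v)
  have h2 := (((hs.const_mul κ).smul_const z.1).add (hc.smul_const z.2)).add (hs.smul_const v)
  refine (h1.prodMk h2).congr_deriv ?_
  simp only [Prod.neg_mk, Prod.mk.injEq]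
  constructor <;> module

end IsOscillatorPair

end Oscillator

/-! ### The bracket as a derivative along the Hamiltonian vector field -/

section Bracket

variable {d : ℕ}

/-- The linear part `(u₁, …, u_d)` of the control. -/
noncomputable def linearForce (u : Fin (d + 1) → ℝ) : EuclideanSpace ℝ (Fin d) :=
  WithLp.toLp 2 fun j ↦ u j.succ

theorem fderiv_oscillatorHamiltonian (u : Fin (d + 1) → ℝ) (z v : PhaseSpace d) :
    fderiv ℝ (oscillatorHamiltonian u) z v =
      inner ℝ z.2 v.2 + u 0 * inner ℝ z.1 v.1 + ∑ j : Fin d, u j.succ * v.1 j := by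
  have h1 : HasFDerivAt (fun z : PhaseSpace d ↦ ‖z.1‖ ^ 2) _ z := hasFDerivAt_fst.norm_sq
  have h2 : HasFDerivAt (fun z : PhaseSpace d ↦ ‖z.2‖ ^ 2) _ z := hasFDerivAt_snd.norm_sq
  have h3 : HasFDerivAt (fun z : PhaseSpace d ↦ ∑ j : Fin d, u j.succ * z.1 j) _ z :=
    HasFDerivAt.fun_sum fun j _ ↦
      (((EuclideanSpace.proj (𝕜 := ℝ) j).hasFDerivAt.comp z hasFDerivAt_fst).const_mul (u j.succ))
  have h := ((h2.mul_const (2⁻¹ : ℝ)).add ((h1.mul_const (2⁻¹ : ℝ)).const_mul (u 0))).add h3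
  have e : oscillatorHamiltonian u = fun z : PhaseSpace d ↦
      (‖z.2‖ ^ 2 * 2⁻¹ + u 0 * (‖z.1‖ ^ 2 * 2⁻¹)) + ∑ j : Fin d, u j.succ * z.1 j := by
    funext z
    simp only [oscillatorHamiltonian, div_eq_mul_inv]
  have h' := h.fderiv
  rw [e]
  refine (congrArg (fun L ↦ L v) h').trans ?_
  simp

theorem poissonBracket_oscillatorHamiltonian (u : Fin (d + 1) → ℝ) (φ : PhaseSpace d → ℝ)
    (z : PhaseSpace d) :
    poissonBracket (oscillatorHamiltonian u) φ z =
      fderiv ℝ φ z (z.2, -(u 0 • z.1 + linearForce u)) := by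
  have e : ((z.2, -(u 0 • z.1 + linearForce u)) : PhaseSpace d) =
      ∑ i : Fin d, (z.2 i • ((EuclideanSpace.single i 1, 0) : PhaseSpace d)
        - (u 0 * z.1 i + u i.succ) • ((0, EuclideanSpace.single i 1) : PhaseSpace d)) := by
    refine Prod.ext ?_ ?_
    · ext j
      simp [Prod.fst_sum, Finset.sum_apply, Pi.single_apply]
    · ext j
      simp [Prod.snd_sum, Finset.sum_apply, Pi.single_apply, linearForce]

  rw [e, map_sum]
  refine Finset.sum_congr rfl fun i _ ↦ ?_
  rw [map_sub, map_smul, map_smul, fderiv_oscillatorHamiltonian, fderiv_oscillatorHamiltonian]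
  simp [EuclideanSpace.inner_single_right]

theorem continuous_poissonBracket_oscillatorHamiltonian (u : Fin (d + 1) → ℝ)
    {φ : PhaseSpace d → ℝ} (hφ : ContDiff ℝ ∞ φ) :
    Continuous (poissonBracket (oscillatorHamiltonian u) φ) := by
  have h := hφ.continuous_fderiv (by simp)
  rw [funext (poissonBracket_oscillatorHamiltonian u φ)]
  exact h.clm_apply (by fun_prop)

theorem hasCompactSupport_poissonBracket (f : PhaseSpace d → ℝ)
    {φ : PhaseSpace d → ℝ} (hφ : HasCompactSupport φ) :
    HasCompactSupport (poissonBracket f φ) := by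
  refine (hφ.fderiv (𝕜 := ℝ)).mono' fun z hz ↦ subset_tsupport _ ?_
  intro h
  apply hz
  simp [poissonBracket, h]

end Bracket

/-! ### Weak Liouville equation for a constant control -/

section ConstantControl

variable {d : ℕ} {κ : ℝ} {f s : ℝ → ℝ} {p : ℝ≥0∞}

namespace IsOscillatorPair

theorem integral_pullback_flow_mul (h : IsOscillatorPair κ f s) (v : EuclideanSpace ℝ (Fin d))
    (ρ : Lp ℝ p (volume : Measure (PhaseSpace d))) (φ : PhaseSpace d → ℝ) (t : ℝ) :
    ∫ z, (h.flow v t).pullback ρ z * φ z = ∫ z, ρ z * φ ((h.flow v (-t)).1 z) := by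
  have e : ∫ z, (h.flow v t).pullback ρ z * φ z = ∫ z, ρ ((h.flow v t).1 z) * φ z := by
    refine integral_congr_ae ?_
    filter_upwards [(h.flow v t).coeFn_pullback ρ] with z hz
    rw [hz]
  have hinj : Function.Injective (h.flow v (-t)).1 :=
    Function.LeftInverse.injective (g := (h.flow v t).1) (h.flow_flow_neg v t)
  rw [e, ← (h.flow v (-t)).2.integral_comp
    ((h.flow v (-t)).1.continuous.measurableEmbedding hinj)]
  simp_rw [h.flow_flow_neg]

/-- Justifies Fubini. For times between `0` and `t` the transported supports stay in one compact set
`K`, so `ρ` may be truncated to `K`, where it is integrable, and multiplied by a bounded factor. -/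
theorem integrable_mul_comp_flow_neg (h : IsOscillatorPair κ f s)
    (v : EuclideanSpace ℝ (Fin d)) {ρ : PhaseSpace d → ℝ} (hρ : LocallyIntegrable ρ)
    {G : PhaseSpace d → ℝ} (hG : Continuous G) (hG' : HasCompactSupport G) (t : ℝ) :
    Integrable (Function.uncurry fun (x : ℝ) (z : PhaseSpace d) ↦ ρ z * G ((h.flow v (-x)).1 z))
      ((volume.restrict (uIoc 0 t)).prod volume) := by
  obtain ⟨K, hK, hKG⟩ : ∃ K : Set (PhaseSpace d), IsCompact K ∧
      ∀ x ∈ uIoc 0 t, ∀ z ∉ K, G ((h.flow v (-x)).1 z) = 0 := by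
    refine ⟨_, ((isCompact_uIcc (a := 0) (b := t)).prod hG').image (h.continuous_flow_apply v),
      fun x hx z hz ↦ ?_⟩
    by_contra hne
    exact hz ⟨(x, (h.flow v (-x)).1 z),
      ⟨uIoc_subset_uIcc hx, subset_tsupport _ hne⟩, h.flow_flow_neg v _ _⟩
  have h1 : Integrable (K.indicator ρ) volume :=
    (hρ.integrableOn_isCompact hK).integrable_indicator hK.measurableSet
  obtain ⟨C, hC⟩ := hG'.exists_bound_of_continuous hG
  have hneg : Continuous fun x : ℝ × PhaseSpace d ↦ (-x.1, x.2) := by fun_prop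
  have hcont := hG.comp ((h.continuous_flow_apply v).comp hneg)
  have : IsFiniteMeasure (volume.restrict (uIoc 0 t)) := by
    unfold uIoc
    infer_instance
  have h2 := (h1.comp_snd (volume.restrict (uIoc 0 t))).mul_bdd (c := C)
    hcont.aestronglyMeasurable (ae_of_all _ fun x ↦ hC _)
  refine h2.congr ?_
  have hx : ∀ᵐ x ∂((volume.restrict (uIoc 0 t)).prod (volume : Measure (PhaseSpace d))),
      x.1 ∈ uIoc 0 t :=
    Measure.quasiMeasurePreserving_fst.ae (ae_restrict_mem measurableSet_uIoc)
  filter_upwards [hx] with x hx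
  change K.indicator ρ x.2 * G ((h.flow v (-x.1)).1 x.2) = ρ x.2 * G ((h.flow v (-x.1)).1 x.2)
  by_cases hz : x.2 ∈ K
  · rw [indicator_of_mem hz]
  · rw [hKG _ hx _ hz, mul_zero, mul_zero]

theorem intervalIntegrable_integral_pullback_flow [Fact (1 ≤ p)] (h : IsOscillatorPair κ f s)
    (v : EuclideanSpace ℝ (Fin d)) (ρ : Lp ℝ p (volume : Measure (PhaseSpace d)))
    {G : PhaseSpace d → ℝ} (hG : Continuous G) (hG' : HasCompactSupport G) (t : ℝ) :
    IntervalIntegrable (fun x ↦ ∫ z, (h.flow v x).pullback ρ z * G z) volume 0 t := by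
  simp_rw [integral_pullback_flow_mul]
  rw [intervalIntegrable_iff]
  exact (h.integrable_mul_comp_flow_neg v ((Lp.memLp ρ).locallyIntegrable Fact.out)
    hG hG' t).integral_prod_left

theorem hasDerivAt_comp_flow_neg {u : Fin (d + 1) → ℝ} (h : IsOscillatorPair (u 0) f s)
    {φ : PhaseSpace d → ℝ} (hφ : ContDiff ℝ ∞ φ) (z : PhaseSpace d) (t : ℝ) :
    HasDerivAt (fun x ↦ φ ((h.flow (linearForce u) (-x)).1 z))
      (-poissonBracket (oscillatorHamiltonian u) φ ((h.flow (linearForce u) (-t)).1 z)) t := by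
  have h1 := ((hφ.differentiable (by simp)).differentiableAt.hasFDerivAt).comp_hasDerivAt t
    (h.hasDerivAt_flow_neg (linearForce u) t z)
  refine h1.congr_deriv ?_
  rw [poissonBracket_oscillatorHamiltonian, map_neg]

/-- No regularity of `ρ` is needed: a volume preserving change of variables moves the flow onto the
test function. After Fubini, the fundamental theorem of calculus applies along each trajectory. -/
theorem weak_equation [Fact (1 ≤ p)] {u : Fin (d + 1) → ℝ} (h : IsOscillatorPair (u 0) f s)
    (ρ : Lp ℝ p (volume : Measure (PhaseSpace d)))
    {φ : PhaseSpace d → ℝ} (hφ : ContDiff ℝ ∞ φ) (hφ' : HasCompactSupport φ) (t : ℝ) :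
    ∫ z, (h.flow (linearForce u) t).pullback ρ z * φ z =
      (∫ z, ρ z * φ z) - ∫ x in (0 : ℝ)..t,
        ∫ z, (h.flow (linearForce u) x).pullback ρ z *
          poissonBracket (oscillatorHamiltonian u) φ z := by
  have hρ := (Lp.memLp ρ).locallyIntegrable (Fact.out : 1 ≤ p)
  have hG := continuous_poissonBracket_oscillatorHamiltonian u hφ
  have hG' := hasCompactSupport_poissonBracket (oscillatorHamiltonian u) hφ'
  have hint : ∀ x : ℝ,
      Integrable (fun z ↦ ρ z * φ ((h.flow (linearForce u) (-x)).1 z)) volume := by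
    intro x
    refine hρ.integrable_smul_right_of_hasCompactSupport
      (hφ.continuous.comp (h.flow (linearForce u) (-x)).1.continuous) ?_
    have hhomeo : Topology.IsClosedEmbedding (h.flow (linearForce u) (-x)).1 := by
      let e : PhaseSpace d ≃ₜ PhaseSpace d :=
        { toFun := (h.flow (linearForce u) (-x)).1
          invFun := (h.flow (linearForce u) x).1
          left_inv := h.flow_flow_neg _ _
          right_inv := h.flow_neg_flow _ _ }
      exact e.isClosedEmbedding
    exact hφ'.comp_isClosedEmbedding hhomeo
  simp_rw [integral_pullback_flow_mul]
  rw [intervalIntegral_integral_swap (h.integrable_mul_comp_flow_neg _ hρ hG hG' t)]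
  have e : ∀ z, ∫ x in (0 : ℝ)..t, ρ z * poissonBracket (oscillatorHamiltonian u) φ
        ((h.flow (linearForce u) (-x)).1 z) =
      ρ z * φ z - ρ z * φ ((h.flow (linearForce u) (-t)).1 z) := by
    intro z
    have hc : Continuous fun x ↦ -poissonBracket (oscillatorHamiltonian u) φ
        ((h.flow (linearForce u) (-x)).1 z) :=
      (hG.comp ((h.continuous_flow_apply _).comp (by fun_prop :
        Continuous fun x : ℝ ↦ (-x, z)))).neg
    have := intervalIntegral.integral_eq_sub_of_hasDerivAt
      (fun x _ ↦ h.hasDerivAt_comp_flow_neg hφ z x) (hc.intervalIntegrable 0 t)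
    rw [intervalIntegral.integral_neg, neg_zero, h.flow_zero] at this
    rw [intervalIntegral.integral_const_mul]
    linear_combination (-ρ z) * this
  simp_rw [e]
  have h0 := hint 0
  simp_rw [neg_zero, h.flow_zero] at h0
  rw [integral_sub h0 (hint t)]
  ring

end IsOscillatorPair

end ConstantControl

/-! ### Concatenation in time -/

/-- Concatenation of two functions of time: `f` up to time `τ`, then `g` restarted at `τ`. -/
noncomputable def timeConcat {E : Type*} (τ : ℝ) (f g : ℝ → E) (x : ℝ) : E :=
  if x ≤ τ then f x else g (x - τ)

section TimeConcat

variable {E : Type*} {τ τ' : ℝ} {f g : ℝ → E}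

theorem timeConcat_of_le {x : ℝ} (hx : x ≤ τ) : timeConcat τ f g x = f x := if_pos hx

theorem timeConcat_of_lt {x : ℝ} (hx : τ < x) : timeConcat τ f g x = g (x - τ) :=
  if_neg hx.not_ge

theorem timeConcat_of_ge (h : f τ = g 0) {x : ℝ} (hx : τ ≤ x) :
    timeConcat τ f g x = g (x - τ) := by
  rcases hx.eq_or_lt with rfl | hx
  · rw [timeConcat_of_le le_rfl, sub_self, h]
  · exact timeConcat_of_lt hx

theorem continuousOn_timeConcat [TopologicalSpace E] (hτ : 0 ≤ τ) (hτ' : 0 ≤ τ')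
    (h : f τ = g 0) (hf : ContinuousOn f (Icc 0 τ)) (hg : ContinuousOn g (Icc 0 τ')) :
    ContinuousOn (timeConcat τ f g) (Icc 0 (τ + τ')) := by
  rw [← Icc_union_Icc_eq_Icc hτ (le_add_of_nonneg_right hτ')]
  refine ContinuousOn.union_of_isClosed ?_ ?_ isClosed_Icc isClosed_Icc
  · exact hf.congr fun x hx ↦ timeConcat_of_le hx.2
  · have : ContinuousOn (fun x ↦ g (x - τ)) (Icc τ (τ + τ')) :=
      hg.comp (by fun_prop) fun x hx ↦ ⟨by linarith [hx.1], by linarith [hx.2]⟩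
    exact this.congr fun x hx ↦ timeConcat_of_ge h hx.1

theorem IsPiecewiseConstantOn.timeConcat (hf : IsPiecewiseConstantOn τ f)
    (hg : IsPiecewiseConstantOn τ' g) :
    IsPiecewiseConstantOn (τ + τ') (timeConcat τ f g) := by
  obtain ⟨n, t, ht, ht0, htn, htc⟩ := hf
  obtain ⟨m, r, hr, hr0, hrm, hrc⟩ := hg
  have hlow : ∀ i ≤ n, t i ≤ τ := fun i hi ↦ htn ▸ ht hi
  have hup : ∀ i, 0 ≤ r i := fun i ↦ hr0 ▸ hr (Nat.zero_le i)
  refine ⟨n + m, fun i ↦ if i ≤ n then t i else τ + r (i - n), ?_, ?_, ?_, ?_⟩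
  · intro i j hij
    dsimp only
    split_ifs with hi hj hj
    · exact ht hij
    · linarith [hlow i hi, hup (j - n)]
    · omega
    · linarith [hr (show i - n ≤ j - n by omega)]
  · simp [ht0]
  · dsimp only
    split_ifs with h
    · obtain rfl : m = 0 := by omega
      rw [← hrm, hr0, add_zero, add_zero, htn]
    · rw [Nat.add_sub_cancel_left, hrm]
  · intro i hi
    rcases lt_or_ge i n with hin | hin
    · obtain ⟨c, hc⟩ := htc i hin
      refine ⟨c, fun x hx ↦ ?_⟩
      simp only [if_pos hin.le] at hx
      rw [if_pos (Nat.succ_le_of_lt hin)] at hx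
      rw [timeConcat_of_le (hx.2.le.trans (hlow _ hin)), hc x hx]
    · obtain ⟨c, hc⟩ := hrc (i - n) (by omega)
      refine ⟨c, fun x hx ↦ ?_⟩
      -- At the junction `i = n` the two formulas agree, since `t n = τ` and `r 0 = 0`.
      have e : (if i ≤ n then t i else τ + r (i - n)) = τ + r (i - n) := by
        split_ifs with h
        · obtain rfl : i = n := le_antisymm h hin
          rw [Nat.sub_self, hr0, htn, add_zero]
        · rfl
      dsimp only at hx
      rw [e, if_neg (by omega), show i + 1 - n = i - n + 1 by omega] at hx
      rw [timeConcat_of_lt (by linarith [hx.1, hup (i - n)])]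
      exact hc _ ⟨by linarith [hx.1], by linarith [hx.2]⟩

end TimeConcat

/-! ### Maps realized by piecewise constant controls -/

section Steering

variable {d : ℕ} {p : ℝ≥0∞} [Fact (1 ≤ p)]

/-- The pairing of `{H_{u(x)}, ρ(x)}` with a test function `φ`, in weak form. -/
noncomputable def liouvillePairing (u : ℝ → Fin (d + 1) → ℝ)
    (ρ : ℝ → Lp ℝ p (volume : Measure (PhaseSpace d))) (φ : PhaseSpace d → ℝ) (x : ℝ) : ℝ :=
  ∫ z, ρ x z * poissonBracket (oscillatorHamiltonian (u x)) φ z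

/-- `ρ` is a solution for which the time integrals in the weak formulation converge. -/
def IsIntegrableLiouvilleSolution (τ : ℝ) (u : ℝ → Fin (d + 1) → ℝ)
    (ρ₀ : Lp ℝ p (volume : Measure (PhaseSpace d)))
    (ρ : ℝ → Lp ℝ p (volume : Measure (PhaseSpace d))) : Prop :=
  IsLiouvilleSolution τ u ρ₀ ρ ∧
    ∀ φ : PhaseSpace d → ℝ, ContDiff ℝ ∞ φ → HasCompactSupport φ →
      IntervalIntegrable (liouvillePairing u ρ φ) volume 0 τ

/-- Splitting the time integral at `τ` requires integrability on both pieces, which is why it is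
carried along with the weak equation. -/
theorem IsIntegrableLiouvilleSolution.timeConcat {τ τ' : ℝ} (hτ : 0 ≤ τ) (hτ' : 0 ≤ τ')
    {u u' : ℝ → Fin (d + 1) → ℝ} {ρ₀ : Lp ℝ p (volume : Measure (PhaseSpace d))}
    {ρ ρ' : ℝ → Lp ℝ p (volume : Measure (PhaseSpace d))}
    (h : IsIntegrableLiouvilleSolution τ u ρ₀ ρ)
    (h' : IsIntegrableLiouvilleSolution τ' u' (ρ τ) ρ') :
    IsIntegrableLiouvilleSolution (τ + τ') (timeConcat τ u u') ρ₀ (timeConcat τ ρ ρ') := by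
  obtain ⟨⟨hc, h0, hw⟩, hi⟩ := h
  obtain ⟨⟨hc', h0', hw'⟩, hi'⟩ := h'
  have ele : ∀ φ, ∀ x ≤ τ, liouvillePairing (_root_.timeConcat τ u u')
      (_root_.timeConcat τ ρ ρ') φ x = liouvillePairing u ρ φ x := fun φ x hx ↦ by
    simp only [liouvillePairing, timeConcat_of_le hx]
  have elt : ∀ φ, ∀ x, τ < x → liouvillePairing (_root_.timeConcat τ u u')
      (_root_.timeConcat τ ρ ρ') φ x = liouvillePairing u' ρ' φ (x - τ) := fun φ x hx ↦ by
    simp only [liouvillePairing, timeConcat_of_lt hx]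
  have i1 : ∀ φ : PhaseSpace d → ℝ, ContDiff ℝ ∞ φ → HasCompactSupport φ →
      IntervalIntegrable (liouvillePairing (_root_.timeConcat τ u u')
        (_root_.timeConcat τ ρ ρ') φ) volume 0 τ := fun φ hφ hφ' ↦ by
    refine (intervalIntegrable_congr fun x hx ↦ ?_).1 (hi φ hφ hφ')
    rw [uIoc_of_le hτ] at hx
    exact (ele φ x hx.2).symm
  have i2 : ∀ φ : PhaseSpace d → ℝ, ContDiff ℝ ∞ φ → HasCompactSupport φ →
      IntervalIntegrable (liouvillePairing (_root_.timeConcat τ u u')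
        (_root_.timeConcat τ ρ ρ') φ) volume τ (τ + τ') := fun φ hφ hφ' ↦ by
    have := (hi' φ hφ hφ').comp_sub_right τ
    rw [zero_add, add_comm τ' τ] at this
    refine (intervalIntegrable_congr fun x hx ↦ ?_).1 this
    rw [uIoc_of_le (by linarith)] at hx
    exact (elt φ x hx.1).symm
  refine ⟨⟨continuousOn_timeConcat hτ hτ' h0'.symm hc hc', ?_, ?_⟩,
    fun φ hφ hφ' ↦ (i1 φ hφ hφ').trans (i2 φ hφ hφ')⟩
  · rw [timeConcat_of_le hτ, h0]
  · intro φ hφ hφ' t ht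
    have hfirst : ∀ t ∈ Icc 0 τ, ∫ x in (0 : ℝ)..t, liouvillePairing (_root_.timeConcat τ u u')
        (_root_.timeConcat τ ρ ρ') φ x = ∫ x in (0 : ℝ)..t, liouvillePairing u ρ φ x := by
      intro t ht
      refine intervalIntegral.integral_congr fun x hx ↦ ele φ x ?_
      rw [uIcc_of_le ht.1] at hx
      exact hx.2.trans ht.2
    change _ = _ - ∫ x in (0 : ℝ)..t, liouvillePairing (_root_.timeConcat τ u u')
        (_root_.timeConcat τ ρ ρ') φ x
    rcases le_total t τ with htτ | htτ
    · rw [timeConcat_of_le htτ, hfirst t ⟨ht.1, htτ⟩]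
      exact hw φ hφ hφ' t ⟨ht.1, htτ⟩
    · have hsecond : ∫ x in τ..t, liouvillePairing (_root_.timeConcat τ u u')
          (_root_.timeConcat τ ρ ρ') φ x =
            ∫ x in (0 : ℝ)..(t - τ), liouvillePairing u' ρ' φ x := by
        rw [← sub_self τ, ← intervalIntegral.integral_comp_sub_right]
        refine intervalIntegral.integral_congr_ae (ae_of_all _ fun x hx ↦ elt φ x ?_)
        rw [uIoc_of_le htτ] at hx
        exact hx.1
      have hsub : uIcc τ t ⊆ uIcc τ (τ + τ') := by
        rw [uIcc_of_le htτ, uIcc_of_le (by linarith)]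
        exact Icc_subset_Icc_right ht.2
      rw [← intervalIntegral.integral_add_adjacent_intervals (i1 φ hφ hφ')
        ((i2 φ hφ hφ').mono_set hsub), hfirst τ ⟨hτ, le_rfl⟩, hsecond,
        timeConcat_of_ge h0'.symm htτ]
      have e1 := hw φ hφ hφ' τ ⟨hτ, le_rfl⟩
      have e2 := hw' φ hφ hφ' (t - τ) ⟨by linarith, by linarith [ht.2]⟩
      rw [e2, e1]
      simp only [liouvillePairing]
      ring

/-- `g` is realized in time `τ`: some piecewise constant control on `[0, τ]` steers every
`ρ₀` in `Lᵖ` to `ρ₀ ∘ g`. -/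
def IsRealizedIn (p : ℝ≥0∞) [Fact (1 ≤ p)] (τ : ℝ) (g : VolumePreservingMap d) : Prop :=
  0 ≤ τ ∧ ∃ u : ℝ → Fin (d + 1) → ℝ, IsPiecewiseConstantOn τ u ∧
    ∀ ρ₀ : Lp ℝ p (volume : Measure (PhaseSpace d)),
      ∃ ρ : ℝ → Lp ℝ p (volume : Measure (PhaseSpace d)),
        IsIntegrableLiouvilleSolution τ u ρ₀ ρ ∧ ρ τ = g.pullback ρ₀

/-- Pullback reverses composition: the control for the outer map `g` acts first, and that for `g'`
then starts from `ρ₀ ∘ g`. -/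
theorem IsRealizedIn.comp {τ τ' : ℝ} {g g' : VolumePreservingMap d} (h : IsRealizedIn p τ g)
    (h' : IsRealizedIn p τ' g') : IsRealizedIn p (τ + τ') (g.comp g') := by
  obtain ⟨hτ, u, hu, hs⟩ := h
  obtain ⟨hτ', u', hu', hs'⟩ := h'
  refine ⟨add_nonneg hτ hτ', _, hu.timeConcat hu', fun ρ₀ ↦ ?_⟩
  obtain ⟨ρ, hρ, e⟩ := hs ρ₀
  obtain ⟨ρ', hρ', e'⟩ := hs' (ρ τ)
  refine ⟨_, hρ.timeConcat hτ hτ' hρ', ?_⟩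
  rw [timeConcat_of_ge hρ'.1.2.1.symm (le_add_of_nonneg_right hτ'), add_sub_cancel_left, e', e,
    VolumePreservingMap.pullback_comp]

theorem IsOscillatorPair.isRealizedIn_flow (hp : p ≠ ⊤) {κ : ℝ} {f s : ℝ → ℝ}
    (h : IsOscillatorPair κ f s) (v : EuclideanSpace ℝ (Fin d)) {τ : ℝ} (hτ : 0 ≤ τ) :
    IsRealizedIn p τ (h.flow v τ) := by
  obtain ⟨u, rfl, rfl⟩ : ∃ u : Fin (d + 1) → ℝ, u 0 = κ ∧ linearForce u = v :=
    ⟨Fin.cons κ fun j ↦ v j, rfl, rfl⟩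
  refine ⟨hτ, fun _ ↦ u, ⟨1, fun i ↦ if i = 0 then 0 else τ, ?_, rfl, rfl,
    fun _ _ ↦ ⟨u, fun _ _ ↦ rfl⟩⟩, fun ρ₀ ↦ ⟨fun t ↦ (h.flow (linearForce u) t).pullback ρ₀,
    ⟨⟨?_, ?_, ?_⟩, ?_⟩, rfl⟩⟩
  · intro i j hij
    dsimp only
    split_ifs with hi hj
    · exact le_rfl
    · exact hτ
    · omega
    · exact le_rfl
  · exact ((VolumePreservingMap.continuous_pullback hp ρ₀).comp
      (h.continuous_flow (linearForce u))).continuousOn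
  · refine Lp.ext ?_
    filter_upwards [(h.flow (linearForce u) 0).coeFn_pullback ρ₀] with z hz
    rw [hz, h.flow_zero]
  · exact fun φ hφ hφ' t _ ↦ h.weak_equation ρ₀ hφ hφ' t
  · exact fun φ hφ hφ' ↦ h.intervalIntegrable_integral_pullback_flow (linearForce u) ρ₀
      (continuous_poissonBracket_oscillatorHamiltonian u hφ)
      (hasCompactSupport_poissonBracket _ hφ') τ

/-! ### Limits of maps realized in small time -/

/-- Maps which are limits of maps realized in time at most `ε`. -/
def approxRealized (d : ℕ) (p : ℝ≥0∞) [Fact (1 ≤ p)] (ε : ℝ) : Set (VolumePreservingMap d) :=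
  closure {g | ∃ τ ≤ ε, IsRealizedIn p τ g}

theorem comp_mem_approxRealized {ε ε' : ℝ} {g g' : VolumePreservingMap d}
    (h : g ∈ approxRealized d p ε) (h' : g' ∈ approxRealized d p ε') :
    g.comp g' ∈ approxRealized d p (ε + ε') := by
  refine map_mem_closure₂ VolumePreservingMap.continuous_uncurry_comp h h' ?_
  rintro a ⟨τ, hτ, ha⟩ b ⟨τ', hτ', hb⟩
  exact ⟨τ + τ', add_le_add hτ hτ', ha.comp hb⟩

/-- Free transport `(q, p) ↦ (q + δ p, p)` takes time `δ`. -/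
theorem shear_snd_mem_approxRealized (hp : p ≠ ⊤) {δ : ℝ} (hδ : 0 ≤ δ) :
    sympAffine (d := d) 1 δ 0 1 0 0 (by simp) ∈ approxRealized d p δ := by
  refine subset_closure ⟨δ, le_rfl, ?_⟩
  convert isOscillatorPair_zero.isRealizedIn_flow hp (0 : EuclideanSpace ℝ (Fin d)) hδ
  refine sympAffine_eq ?_
  simp [IsOscillatorPair.flow, sympAffine]

/-- The kicks `(q, p) ↦ (q, p + r q + w)` take arbitrarily little time. -/
theorem shear_fst_mem_approxRealized (hp : p ≠ ⊤) {ε : ℝ} (hε : 0 < ε) (r : ℝ)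
    (w : EuclideanSpace ℝ (Fin d)) :
    sympAffine 1 0 r 1 0 w (by simp) ∈ approxRealized d p ε := by
  obtain ⟨f, s, h⟩ := exists_isOscillatorPair (-r)
  -- `dslope s 0` extends `s θ / θ` continuously by `s'(0) = 1`, so the family of flows below has a
  -- limit at `θ = 0`.
  have hm : Continuous (dslope s 0) :=
    continuous_iff_continuousAt.2 fun t ↦ by
      rcases eq_or_ne t 0 with rfl | ht
      · exact continuousAt_dslope_same.2 (h.hasDerivAt_snd 0).differentiableAt
      · exact (continuousAt_dslope_of_ne ht).2 h.continuous_snd.continuousAt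
  have hm0 : dslope s 0 0 = 1 := by
    rw [dslope_same, (h.hasDerivAt_snd 0).deriv, h.fst_zero]
    simp
  have hms : ∀ t, s t = t * dslope s 0 t := fun t ↦ by
    have := sub_smul_dslope s 0 t
    rw [h.snd_zero] at this
    simpa using this.symm
  have hf := h.continuous_fst
  have hs := h.continuous_snd
  have hdet : ∀ θ, (1 + r * f θ) * (1 + r * f θ) - (θ * s θ) * (r * dslope s 0 θ) = 1 := by
    intro θ
    linear_combination h.det_eq_one θ + r * s θ * hms θ
  -- For `θ > 0` this is the flow at time `θ ^ 2` with `κ = -r / θ ^ 2` and force `-w / θ ^ 2`,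
  -- obtained by rescaling the pair for `-r` by `θ`. At `θ = 0` it is the kick.
  have hγ : Continuous fun θ ↦ sympAffine (1 + r * f θ) (θ * s θ) (r * dslope s 0 θ) (1 + r * f θ)
      (f θ • w) (dslope s 0 θ • w) (hdet θ) :=
    continuous_sympAffine hdet (by fun_prop) (by fun_prop) (by fun_prop) (by fun_prop)
      (by fun_prop) (by fun_prop)
  have hmem : (0 : ℝ) ∈ closure (Ioo 0 (√ε)) := by
    rw [closure_Ioo (Real.sqrt_pos.2 hε).ne]
    exact left_mem_Icc.2 (Real.sqrt_nonneg ε)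
  have key := map_mem_closure (t := {g | ∃ τ ≤ ε, IsRealizedIn p τ g}) hγ hmem ?_
  · have e : sympAffine 1 0 r 1 0 w (by simp) = sympAffine (1 + r * f 0) (0 * s 0)
        (r * dslope s 0 0) (1 + r * f 0) (f 0 • w) (dslope s 0 0 • w) (hdet 0) := by
      refine sympAffine_eq ?_
      simp only [sympAffine, hm0, h.fst_zero]
      simp
    rw [e]
    exact key
  · intro θ hθ
    have hθ0 : θ ≠ 0 := hθ.1.ne'
    refine ⟨θ ^ 2, ((Real.lt_sqrt hθ.1.le).1 hθ.2).le, ?_⟩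
    convert (h.rescale hθ0).isRealizedIn_flow hp (-(θ ^ 2)⁻¹ • w) (sq_nonneg θ)
    refine sympAffine_eq ?_
    have e1 : θ ^ 2 / θ = θ := by field_simp
    have hc : 1 + r * f θ = 1 - -r / θ ^ 2 * (θ ^ 2 * f θ) := by field_simp; ring
    have hd : r * dslope s 0 θ = -(-r / θ ^ 2 * (θ * s θ)) := by
      rw [hms θ]
      field_simp
    have hv : f θ • w = -(θ ^ 2 * f θ) • -(θ ^ 2)⁻¹ • w := by
      rw [smul_smul]
      congr 1
      field_simp
    have hv' : dslope s 0 θ • w = -(θ * s θ) • -(θ ^ 2)⁻¹ • w := by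
      rw [smul_smul, hms θ]
      congr 1
      field_simp
    simp only [IsOscillatorPair.flow, sympAffine, e1, ContinuousMap.coe_mk, ← hc, ← hd, ← hv,
      ← hv']

theorem sympAffine_mem_approxRealized_of_ne_zero (hp : p ≠ ⊤) {ε : ℝ} (hε : 0 < ε)
    {a b c e : ℝ} (s w : EuclideanSpace ℝ (Fin d)) (h : a * e - b * c = 1) (hb : b ≠ 0) :
    sympAffine a b c e s w h ∈ approxRealized d p ε := by
  -- Five factors, each with time budget `δ`: kick, transport, kick, transport, kick.
  obtain ⟨δ, hδ, rfl⟩ : ∃ δ, 0 < δ ∧ ε = δ + (δ + (δ + (δ + δ))) := ⟨ε / 5, by positivity, by ring⟩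
  have hδ' := hδ.ne'
  obtain rfl : c = (a * e - 1) / b := by
    field_simp
    linarith
  -- With middle kick `k`, the upper right entry is `2 * δ + δ ^ 2 * k = b` and both diagonal
  -- entries are `b / δ - 1`; the outer kicks correct these to `a` and `e`. The middle momentum
  -- shift `δ⁻¹ • s` becomes the position shift `s` after one transport, and the last-applied kick
  -- corrects the momentum shift to `w`.
  have key := comp_mem_approxRealized
    (shear_fst_mem_approxRealized hp hδ ((e + 1) / b - 1 / δ)
      (w - δ⁻¹ • s - ((e + 1) / b - 1 / δ) • s))
    (comp_mem_approxRealized (shear_snd_mem_approxRealized (d := d) hp hδ.le)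
      (comp_mem_approxRealized
        (shear_fst_mem_approxRealized hp hδ ((b - 2 * δ) / δ ^ 2) (δ⁻¹ • s))
        (comp_mem_approxRealized (shear_snd_mem_approxRealized (d := d) hp hδ.le)
          (shear_fst_mem_approxRealized hp hδ ((a + 1) / b - 1 / δ) 0))))
  convert key
  refine sympAffine_eq ?_
  change _ = phaseAffine _ _ _ _ _ _ ∘ phaseAffine _ _ _ _ _ _ ∘ phaseAffine _ _ _ _ _ _ ∘
    phaseAffine _ _ _ _ _ _ ∘ phaseAffine _ _ _ _ _ _
  simp only [phaseAffine_comp]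
  congr 1
  · field_simp
    ring
  · field_simp
    ring
  · field_simp
    ring
  · field_simp
    ring
  · simp only [smul_zero, smul_smul, zero_add, add_zero]
    rw [mul_inv_cancel₀ hδ']
    module
  · simp only [smul_zero, smul_smul, zero_add, add_zero]
    rw [mul_inv_cancel₀ hδ']
    module

theorem sympAffine_mem_approxRealized (hp : p ≠ ⊤) {ε : ℝ} (hε : 0 < ε)
    {a b c e : ℝ} (s w : EuclideanSpace ℝ (Fin d)) (h : a * e - b * c = 1) :
    sympAffine a b c e s w h ∈ approxRealized d p ε := by
  by_cases hb : b = 0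
  · subst hb
    have ha : a ≠ 0 := by rintro rfl; simp at h
    -- Split off the unit upper shear on the right; both factors have nonzero upper right entry,
    -- `-a` and `1`.
    have key := comp_mem_approxRealized
      (sympAffine_mem_approxRealized_of_ne_zero (p := p) (a := a) (b := -a) (c := c) (e := e - c)
        hp (half_pos hε) s w (by linarith) (neg_ne_zero.2 ha))
      (sympAffine_mem_approxRealized_of_ne_zero (p := p) (a := 1) (b := 1) (c := 0) (e := 1)
        hp (half_pos hε) (0 : EuclideanSpace ℝ (Fin d)) 0 (by norm_num) one_ne_zero)
    rw [add_halves] at key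
    convert key
    refine sympAffine_eq ?_
    change _ = phaseAffine _ _ _ _ _ _ ∘ phaseAffine _ _ _ _ _ _
    rw [phaseAffine_comp]
    congr 1
    · ring
    · ring
    · ring
    · ring
    · simp
    · simp
  · exact sympAffine_mem_approxRealized_of_ne_zero hp hε s w h hb

theorem isSmallTimeApproxReachable_pullback (hp : p ≠ ⊤) {g : VolumePreservingMap d}
    (hg : ∀ ε > 0, g ∈ approxRealized d p ε) (ρ₀ : Lp ℝ p (volume : Measure (PhaseSpace d))) :
    IsSmallTimeApproxReachable ρ₀ (g.pullback ρ₀) := by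
  intro ε hε
  have h := map_mem_closure (t := (fun g ↦ g.pullback ρ₀) '' {g | ∃ τ ≤ ε, IsRealizedIn p τ g})
    (VolumePreservingMap.continuous_pullback hp ρ₀) (hg ε hε) (mapsTo_image _ _)
  obtain ⟨_, ⟨g', ⟨τ, hτ, hτ0, u, hu, hs⟩, rfl⟩, hdist⟩ := Metric.mem_closure_iff.1 h ε hε
  obtain ⟨ρ, hρ, e⟩ := hs ρ₀
  refine ⟨τ, ⟨hτ0, hτ⟩, u, hu, ρ, hρ.1, ?_⟩
  rw [e, ← dist_eq_norm, dist_comm]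
  exact hdist

theorem exists_affine_isSmallTimeApproxReachable (hp : p ≠ ⊤)
    (ρ₀ : Lp ℝ p (volume : Measure (PhaseSpace d))) {a b c e : ℝ}
    (s w : EuclideanSpace ℝ (Fin d)) (h : a * e - b * c = 1) :
    ∃ ρ₁ : Lp ℝ p (volume : Measure (PhaseSpace d)),
      (∀ᵐ z : PhaseSpace d,
        ρ₁ z = ρ₀ (a • z.1 + b • z.2 + s, c • z.1 + e • z.2 + w)) ∧
      IsSmallTimeApproxReachable ρ₀ ρ₁ :=
  ⟨(sympAffine a b c e s w h).pullback ρ₀, (sympAffine a b c e s w h).coeFn_pullback ρ₀,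
    isSmallTimeApproxReachable_pullback hp
      (fun _ hε ↦ sympAffine_mem_approxRealized hp hε s w h) ρ₀⟩

end Steering

theorem mainTheorem5 (d : ℕ) (p : ℝ≥0∞) [Fact (1 ≤ p)] (hp : p ≠ ⊤)
    (ρ₀ : Lp ℝ p (volume : Measure (PhaseSpace d))) :
    (∀ (α t r : ℝ) (s w : EuclideanSpace ℝ (Fin d)), 0 < α → t * r = 0 →
      ∃ ρ₁ : Lp ℝ p (volume : Measure (PhaseSpace d)),
        (∀ᵐ z : PhaseSpace d,
          ρ₁ z = ρ₀ (α • (z.1 + t • z.2 + s), α⁻¹ • (z.2 + r • z.1 + w))) ∧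
        IsSmallTimeApproxReachable ρ₀ ρ₁) ∧
    (∀ (a b c e : ℝ) (s w : EuclideanSpace ℝ (Fin d)), a * e - b * c = 1 →
      ∃ ρ₁ : Lp ℝ p (volume : Measure (PhaseSpace d)),
        (∀ᵐ z : PhaseSpace d,
          ρ₁ z = ρ₀ (a • z.1 + b • z.2 + s, c • z.1 + e • z.2 + w)) ∧
        IsSmallTimeApproxReachable ρ₀ ρ₁) := by
  refine ⟨fun α t r s w hα htr ↦ ?_,
    fun a b c e s w h ↦ exists_affine_isSmallTimeApproxReachable hp ρ₀ s w h⟩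
  -- The determinant is `1 - t * r`, so the simultaneous substitution preserves volume exactly when
  -- `t * r = 0` or `t * r = 2`; only the former has unit determinant.
  have hdet : α * α⁻¹ - α * t * (α⁻¹ * r) = 1 := by
    have := mul_inv_cancel₀ hα.ne'
    linear_combination (1 - t * r) * this - htr
  obtain ⟨ρ₁, h, hr⟩ :=
    exists_affine_isSmallTimeApproxReachable hp ρ₀ (α • s) (α⁻¹ • w) hdet
  refine ⟨ρ₁, ?_, hr⟩
  filter_upwards [h] with z hz
  rw [hz]
  congr 2
  · module
  · module
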